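/- Let $V$ be a $4$-dimensional real vector space, let $\langle\cdot,\cdot\rangle$ be a non-degenerate symmetric bilinear form on $V$ of signature $(2,2)$, and let $A\in\otimes^4(V^*)$ be an algebraic curvature tensor, i.e. $$A(x,y,z,v)=-A(y,x,z,v)=A(z,v,x,y),\qquad A(x,y,z,v)+A(y,z,x,v)+A(z,x,y,v)=0 .$$ The Jacobi operator $\mathcal J_A(x):V\to V$ is defined by $\langle\mathcal J_A(x)y,z\rangle=A(y,x,x,z)$. Let $S^{\pm}=\{x\in V:\langle x,x\rangle=\pm1\}$ be the sets of unit spacelike $(+)$ and unit timelike $(-)$ vectors, and let $N=\{x\in V: x\neq0,\ \langle x,x\rangle=0\}$ be the set of non-zero null vectors. The model $\mathfrak M=(V,\langle\cdot,\cdot\rangle,A)$ is called spacelike, timelike, or null Osserman if the set of complex eigenvalues of $\mathcal J_A(x)$ is the same for all $x$ in $S^+$, $S^-$, or $N$, respectively; it is called spacelike (timelike) Jordan Osserman if the Jordan normal form of $\mathcal J_A(x)$ is the same for all $x\in S^+$ ($x\in S^-$), that is, if any two of these operators are conjugate. For a basis $\{e_i\}$ of $V$ with $g_{ij}=\langle e_i,e_j\rangle$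 and inverse matrix $(g^{ij})$, let $\rho(x,y)=\sum_{i,j}g^{ij}A(e_i,x,y,e_j)$ be the Ricci tensor, $\tau=\sum_{i,j}g^{ij}\rho(e_i,e_j)$ the scalar curvature, and $$\begin{aligned}W(x,y,z,v)={}&A(x,y,z,v)+\tfrac16\tau\{\langle y,z\rangle\langle x,v\rangle-\langle x,z\rangle\langle y,v\rangle\}\\&-\tfrac12\{\rho(y,z)\langle x,v\rangle-\rho(x,z)\langle y,v\rangle+\rho(x,v)\langle y,z\rangle-\rho(y,v)\langle x,z\rangle\}\end{aligned}$$ the Weyl tensor. $\mathfrak M$ is Einstein if $\rho=c\,\langle\cdot,\cdot\rangle$ for some $c\in\mathbb R$. Given an orientation of $V$ and an oriented orthonormal basis $e_1,\dots,e_4$ with $e_1,e_2$ timelike and $e_3,e_4$ spacelike, the Hodge operator $\star$ on $\Lambda^2(V^*)$ is characterized by $\phi\wedge\star\theta=\langle\phi,\theta\rangle\,e^1\wedge e^2\wedge e^3\wedge e^4$. It satisfies $\star^2=\mathrm{id}$; put $\Lambda^-=\{\theta\in\Lambda^2(V^*):\star\theta=-\theta\}$. $\mathfrak M$ is self-dual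 for this orientation if the Weyl tensor, regarded as the operator $(W\theta)(x,y)=\frac12\sum_{i,j}\langle e_i,e_i\rangle\langle e_j,e_j\rangle W(x,y,e_i,e_j)\,\theta(e_i,e_j)$ on $\Lambda^2(V^*)$, vanishes on $\Lambda^-$. Then the following conditions are equivalent: 1. $\mathfrak M$ is spacelike Osserman. 2. $\mathfrak M$ is timelike Osserman. 3. $\mathfrak M$ is spacelike Jordan Osserman. 4. $\mathfrak M$ is timelike Jordan Osserman. 5. $\mathfrak M$ is Einstein and there is an orientation of $V$ for which $\mathfrak M$ is self-dual. 6. $\mathfrak M$ is null Osserman. -/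

import Mathlib

/-- A model `(V, ⟨·,·⟩, A)`: a nondegenerate symmetric bilinear form on a real vector space,
together with an algebraic curvature tensor. -/
structure CurvatureModel (V : Type*) [AddCommGroup V] [Module ℝ V] where
  form : LinearMap.BilinForm ℝ V
  form_symm : form.IsSymm
  form_nondegenerate : form.Nondegenerate
  A : V →ₗ[ℝ] V →ₗ[ℝ] V →ₗ[ℝ] V →ₗ[ℝ] ℝ
  A_antisymm : ∀ x y z v, A x y z v = -A y x z v
  A_pair_symm : ∀ x y z v, A x y z v = A z v x y
  A_bianchi : ∀ x y z v, A x y z v + A y z x v + A z x y v = 0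

/-- The two-forms `Λ²(V*)`. -/
abbrev TwoForm (V : Type*) [AddCommGroup V] [Module ℝ V] : Type _ := V [⋀^Fin 2]→ₗ[ℝ] ℝ

namespace CurvatureModel

noncomputable section

variable {V : Type*} [AddCommGroup V] [Module ℝ V]

/-- Neutral signature `(2,2)` in dimension four. -/
def IsNeutral (M : CurvatureModel V) : Prop :=
  Module.finrank ℝ V = 4 ∧
    sigPos M.form.toQuadraticMap = 2 ∧
    sigNeg M.form.toQuadraticMap = 2

/-- The spacelike unit vectors `S⁺`. -/
def spacelikeUnit (M : CurvatureModel V) : Set V := {x | M.form x x = 1}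

/-- The timelike unit vectors `S⁻`. -/
def timelikeUnit (M : CurvatureModel V) : Set V := {x | M.form x x = -1}

/-- The nonzero null vectors `N`. -/
def nullCone (M : CurvatureModel V) : Set V := {x | x ≠ 0 ∧ M.form x x = 0}

section Operators

variable [FiniteDimensional ℝ V]

/-- Raising an index: the endomorphism `T` with `⟨T y, z⟩ = B(y, z)`. -/
def raise (M : CurvatureModel V) (B : LinearMap.BilinForm ℝ V) : Module.End ℝ V :=
  (M.form.toDual M.form_nondegenerate).symm.toLinearMap ∘ₗ B

theorem form_raise (M : CurvatureModel V) (B : LinearMap.BilinForm ℝ V) (y z : V) :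
    M.form (M.raise B y) z = B y z := by
  simp [raise, LinearMap.BilinForm.apply_toDual_symm_apply]

/-- The curvature operator `z ↦ R(z, x) y`, where `⟨R(z, x) y, w⟩ = A(z, x, y, w)`. -/
def curv (M : CurvatureModel V) (x y : V) : Module.End ℝ V :=
  M.raise ((M.A.flip x).flip y)

theorem form_curv (M : CurvatureModel V) (x y z w : V) :
    M.form (M.curv x y z) w = M.A z x y w := by
  simp [curv, form_raise]

/-- The Jacobi operator `y ↦ R(y, x) x`, so that `⟨J(x) y, z⟩ = A(y, x, x, z)`. -/
def jacobi (M : CurvatureModel V) (x : V) : Module.End ℝ V := M.curv x x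

/-- The (complex) eigenvalues of the Jacobi operator `J(x)`. -/
def jacobiEigenvalues (M : CurvatureModel V) (x : V) : Set ℂ :=
  {μ | Module.End.HasEigenvalue ((M.jacobi x).baseChange ℂ) μ}

/-- The eigenvalues of the Jacobi operator are constant on `S`. -/
def OssermanOn (M : CurvatureModel V) (S : Set V) : Prop :=
  ∀ x ∈ S, ∀ y ∈ S, M.jacobiEigenvalues x = M.jacobiEigenvalues y

/-- The Jordan normal form of the Jacobi operator is constant on `S`; two endomorphisms have the
same Jordan normal form exactly when they are conjugate. -/
def JordanOssermanOn (M : CurvatureModel V) (S : Set V) : Prop :=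
  ∀ x ∈ S, ∀ y ∈ S, ∃ e : V ≃ₗ[ℝ] V, e.conj (M.jacobi x) = M.jacobi y

def SpacelikeOsserman (M : CurvatureModel V) : Prop := M.OssermanOn M.spacelikeUnit

def TimelikeOsserman (M : CurvatureModel V) : Prop := M.OssermanOn M.timelikeUnit

def NullOsserman (M : CurvatureModel V) : Prop := M.OssermanOn M.nullCone

def SpacelikeJordanOsserman (M : CurvatureModel V) : Prop := M.JordanOssermanOn M.spacelikeUnit

def TimelikeJordanOsserman (M : CurvatureModel V) : Prop := M.JordanOssermanOn M.timelikeUnit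

/-- The Ricci tensor `ρ(x, y) = ∑ gⁱʲ A(eᵢ, x, y, eⱼ)`, the trace of `z ↦ R(z, x) y`. -/
def ricci (M : CurvatureModel V) : LinearMap.BilinForm ℝ V :=
  LinearMap.mk₂ ℝ (fun x y => LinearMap.trace ℝ V (M.curv x y))
    (by
      intro x x' y
      rw [← map_add]
      congr 1
      ext z
      simp [curv, raise])
    (by
      intro c x y
      rw [← map_smul]
      congr 1
      ext z
      simp [curv, raise])
    (by intro x y y'; simp [curv, raise, LinearMap.comp_add])
    (by intro c x y; simp [curv, raise, LinearMap.comp_smul])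

/-- The scalar curvature `τ = ∑ gⁱʲ ρ(eᵢ, eⱼ)`. -/
def scalar (M : CurvatureModel V) : ℝ := LinearMap.trace ℝ V (M.raise M.ricci)

/-- `ρ = c ⟨·,·⟩` for a constant `c`. -/
def IsEinstein (M : CurvatureModel V) : Prop :=
  ∃ c : ℝ, ∀ x y, M.ricci x y = c * M.form x y

/-- The Weyl tensor of a four-dimensional model. -/
def weyl (M : CurvatureModel V) (x y z v : V) : ℝ :=
  M.A x y z v
    + 1 / 6 * M.scalar * (M.form y z * M.form x v - M.form x z * M.form y v)
    - 1 / 2 * (M.ricci y z * M.form x v - M.ricci x z * M.form y v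
        + M.ricci x v * M.form y z - M.ricci y v * M.form x z)

end Operators

/-- The signs `⟨eᵢ, eᵢ⟩` of an orthonormal basis: the first two vectors are timelike, the last
two are spacelike. -/
def frameSign : Fin 4 → ℝ := ![-1, -1, 1, 1]

/-- `b` is an orthonormal basis `e₁, e₂, e₃, e₄` (indexed from `0`) with `e₁, e₂` timelike and
`e₃, e₄` spacelike that is positively oriented for `o`. -/
def IsOrientedFrame (M : CurvatureModel V) (o : Orientation ℝ V (Fin 4))
    (b : Module.Basis (Fin 4) ℝ V) : Prop :=
  b.orientation = o ∧ ∀ i j, M.form (b i) (b j) = if i = j then frameSign i else 0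

/-- The two-form `eⁱ ∧ eʲ` built from the dual basis. -/
def dualWedge (b : Module.Basis (Fin 4) ℝ V) (i j : Fin 4) : TwoForm V :=
  (Matrix.detRowAlternating (n := Fin 2) (R := ℝ)).compLinearMap
    (LinearMap.pi ![b.coord i, b.coord j])

theorem dualWedge_apply (b : Module.Basis (Fin 4) ℝ V) (i j : Fin 4) (x y : V) :
    dualWedge b i j ![x, y] = b.coord i x * b.coord j y - b.coord j x * b.coord i y := by
  refine (Matrix.det_fin_two
    (fun k : Fin 2 => LinearMap.pi ![b.coord i, b.coord j] (![x, y] k))).trans ?_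
  simp

/-- The component `θᵢⱼ = θ(eᵢ, eⱼ)`, as a linear functional of `θ`. -/
def component (b : Module.Basis (Fin 4) ℝ V) (i j : Fin 4) : TwoForm V →ₗ[ℝ] ℝ where
  toFun θ := θ ![b i, b j]
  map_add' _ _ := rfl
  map_smul' _ _ := rfl

/-- The Hodge operator on two-forms, for the orientation and the neutral metric for which `b` is
an oriented orthonormal basis with `e₁, e₂` timelike and `e₃, e₄` spacelike:
`⋆e¹² = e³⁴`, `⋆e¹³ = e²⁴`, `⋆e¹⁴ = -e²³`, `⋆e²³ = -e¹⁴`, `⋆e²⁴ = e¹³`, `⋆e³⁴ = e¹²`. -/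
def hodge (b : Module.Basis (Fin 4) ℝ V) : TwoForm V →ₗ[ℝ] TwoForm V :=
  (component b 0 1).smulRight (dualWedge b 2 3)
    + (component b 0 2).smulRight (dualWedge b 1 3)
    - (component b 0 3).smulRight (dualWedge b 1 2)
    - (component b 1 2).smulRight (dualWedge b 0 3)
    + (component b 1 3).smulRight (dualWedge b 0 2)
    + (component b 2 3).smulRight (dualWedge b 0 1)

/-- The index pairs `i < j`. -/
def indexPairs : Finset (Fin 4 × Fin 4) := Finset.univ.filter fun p => p.1 < p.2

/-- The inner product induced on two-forms, `⟨φ, θ⟩ = ∑_{i<j} gⁱⁱ gʲʲ φᵢⱼ θᵢⱼ`. -/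
def twoFormInner (b : Module.Basis (Fin 4) ℝ V) (φ θ : TwoForm V) : ℝ :=
  ∑ p ∈ indexPairs, frameSign p.1 * frameSign p.2 * component b p.1 p.2 φ * component b p.1 p.2 θ

/-- The value of the four-form `φ ∧ η` on four vectors. -/
def wedgeApply (φ η : TwoForm V) (x y z w : V) : ℝ :=
  φ ![x, y] * η ![z, w] - φ ![x, z] * η ![y, w] + φ ![x, w] * η ![y, z]
    + φ ![y, z] * η ![x, w] - φ ![y, w] * η ![x, z] + φ ![z, w] * η ![x, y]

/-- The identity `φ ∧ ⋆θ = ⟨φ, θ⟩ e¹ ∧ e² ∧ e³ ∧ e⁴` that characterizes the Hodge operator,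
evaluated on the basis. -/
theorem wedgeApply_hodge (b : Module.Basis (Fin 4) ℝ V) (φ θ : TwoForm V) :
    wedgeApply φ (hodge b θ) (b 0) (b 1) (b 2) (b 3) = twoFormInner b φ θ := by
  have hp : indexPairs = {(0, 1), (0, 2), (0, 3), (1, 2), (1, 3), (2, 3)} := by decide
  rw [twoFormInner, hp]
  simp [wedgeApply, hodge, dualWedge_apply, component, frameSign]
  ring

/-- The anti-self-dual two-forms `Λ⁻ = {θ : ⋆θ = -θ}`. -/
def antiSelfDualForms (b : Module.Basis (Fin 4) ℝ V) : Submodule ℝ (TwoForm V) :=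
  LinearMap.ker (hodge b + LinearMap.id)

/-- The Weyl tensor as an operator on two-forms, computed in an orthonormal basis:
`(W θ)ₖₗ = ∑_{i<j} gⁱⁱ gʲʲ W(eₖ, eₗ, eᵢ, eⱼ) θᵢⱼ`. -/
def weylOperator [FiniteDimensional ℝ V] (M : CurvatureModel V) (b : Module.Basis (Fin 4) ℝ V) :
    TwoForm V →ₗ[ℝ] TwoForm V :=
  ∑ q ∈ indexPairs, (∑ p ∈ indexPairs,
    (frameSign p.1 * frameSign p.2 * M.weyl (b q.1) (b q.2) (b p.1) (b p.2)) •
      component b p.1 p.2).smulRight (dualWedge b q.1 q.2)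

/-- Self-duality for the orientation `o`: the restriction `W⁻` of the Weyl operator to `Λ⁻`
vanishes. The Hodge operator and the Weyl operator do not depend on the choice of the oriented
orthonormal basis in which they are computed. -/
def IsSelfDual [FiniteDimensional ℝ V] (M : CurvatureModel V)
    (o : Orientation ℝ V (Fin 4)) : Prop :=
  ∃ b : Module.Basis (Fin 4) ℝ V, M.IsOrientedFrame o b ∧
    (M.weylOperator b).domRestrict (antiSelfDualForms b) = 0

end

end CurvatureModel

/-! The hub is condition 5, and what leads to it is weaker than any Osserman condition:
`NullTraceFree`, the vanishing of tr J(x) and tr J(x)² for every null x. A finite common set of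
eigenvalues bounds both traces. On the null cone the bound forces vanishing because J is quadratic
in x. From a unit pseudo-sphere it passes to the null cone by approximating a null vector by
rescaled unit vectors (`nullTraceFree_of_ossermanOn_unit`).

Since tr J(x) = ρ(x, x), the first trace gives the Einstein condition. For null x, J(x) lives on
x^⊥/x, a plane of signature (1,1) with null directions u and v. Given tr J(x) = 0, tr J(x)² is half
the product of the curvatures A(x,u,x,u) and A(x,v,x,v). One of the bivectors x∧u, x∧v is self-dual,
the other anti-self-dual, and rotating the frame moves the two independently over the null conics of
Λ⁺ and Λ⁻. So a function of α times a function of β vanishes identically (`quartic_mul_eq_zero`),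
and one factor must be zero; reversing the orientation if necessary, it is the anti-self-dual one. A
quadratic form vanishing on the null conic of Λ⁻ is a multiple of the metric there, and the Bianchi
and Einstein identities fix the multiple, so W⁻ = 0.

Conversely, for a self-dual Einstein tensor the para-quaternionic action of self-dual forms on V
gives J(x) = S K S*, where K does not depend on x, S and S* are linear in x, and S S* = S* S = ⟨x,
x⟩. For unit x this is a conjugation, hence the Jordan conditions; for null x it gives J(x)² = 0,
hence the only eigenvalue is 0. -/

namespace CurvatureModel
-- Existence of orthonormal frames of signature (2,2)
variable {V : Type*} [AddCommGroup V] [Module ℝ V]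

/-- `b` is an orthonormal basis whose first two vectors are timelike and whose last two vectors
are spacelike. -/
def IsFrame (M : CurvatureModel V) (b : Module.Basis (Fin 4) ℝ V) : Prop :=
  ∀ i j, M.form (b i) (b j) = if i = j then frameSign i else 0

/-- Sylvester's theorem yields the signs in an unknown order; a bijection between the two sets of
negative indices extends to a permutation that sorts them. -/
theorem exists_equiv_frameSign (w : Fin 4 → ℝ) (hw : ∀ i, w i = -1 ∨ w i = 1)
    (hneg : {i | w i < 0}.ncard = 2) : ∃ σ : Fin 4 ≃ Fin 4, ∀ i, w (σ i) = frameSign i := by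
  classical
  have hf : ∀ i, frameSign i < 0 ↔ i = 0 ∨ i = 1 := by
    intro i; fin_cases i <;> simp [frameSign]
  have hcard : Fintype.card {i // frameSign i < 0} = Fintype.card {i // w i < 0} := by
    have h1 : Fintype.card {i // w i < 0} = 2 := by
      rw [← hneg, ← Nat.card_coe_set_eq, Nat.card_eq_fintype_card]; rfl
    have h2 : Fintype.card {i : Fin 4 // i = 0 ∨ i = 1} = 2 := by decide
    rw [h1, ← h2]
    exact Fintype.card_congr (Equiv.subtypeEquivRight hf)
  let e₁ : {i // frameSign i < 0} ≃ {i // w i < 0} := Fintype.equivOfCardEq hcard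
  refine ⟨e₁.extendSubtype, fun i => ?_⟩
  by_cases hi : frameSign i < 0
  · have h := e₁.extendSubtype_mem i hi
    have hs : frameSign i = -1 := by
      rcases (hf i).1 hi with rfl | rfl <;> simp [frameSign]
    rcases hw (e₁.extendSubtype i) with h' | h'
    · rw [h', hs]
    · rw [h'] at h; norm_num at h
  · have h := e₁.extendSubtype_not_mem i hi
    have hs : frameSign i = 1 := by
      revert hi; fin_cases i <;> simp [frameSign]
    rcases hw (e₁.extendSubtype i) with h' | h'
    · rw [h'] at h; norm_num at h
    · rw [h', hs]

theorem exists_isFrame [FiniteDimensional ℝ V] (M : CurvatureModel V) (hM : M.IsNeutral) :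
    ∃ b, M.IsFrame b := by
  classical
  obtain ⟨hdim, -, hneg⟩ := hM
  have hassoc : QuadraticMap.associated (R := ℝ) M.form.toQuadraticMap = M.form :=
    QuadraticMap.associated_left_inverse ℝ
      (fun x y => by simpa using M.form_symm.eq x y)
  obtain ⟨w, hw, he⟩ := QuadraticForm.equivalent_one_neg_one_weighted_sum_squared
    M.form.toQuadraticMap (by
      rw [hassoc]; exact M.form_nondegenerate.1)
  rw [QuadraticForm.sigNeg_of_equiv_weightedSumSquares he] at hneg
  obtain ⟨e⟩ := he
  -- The weights are indexed by `Fin (finrank ℝ V)`; generalizing over them lets the index type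
  -- become `Fin 4`.
  revert w
  rw [hdim]
  intro w hneg hw e
  obtain ⟨σ, hσ⟩ := exists_equiv_frameSign w hw hneg
  refine ⟨((Pi.basisFun ℝ (Fin 4)).map e.toLinearEquiv.symm).reindex σ.symm, fun i j => ?_⟩
  have hform : ∀ x y : Fin 4 → ℝ, M.form (e.toLinearEquiv.symm x) (e.toLinearEquiv.symm y)
      = ∑ i, w i * (x i * y i) := by
    intro x y
    have hq : ∀ z : Fin 4 → ℝ, M.form (e.toLinearEquiv.symm z) (e.toLinearEquiv.symm z)
        = ∑ i, w i * (z i * z i) := by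
      intro z
      have h := e.map_app (e.toLinearEquiv.symm z)
      rw [show e (e.toLinearEquiv.symm z) = z from e.toLinearEquiv.apply_symm_apply z] at h
      rw [QuadraticMap.weightedSumSquares_apply] at h
      change ∑ i, w i • (z i * z i) = M.form (e.toLinearEquiv.symm z) (e.toLinearEquiv.symm z) at h
      rw [← h]
      rfl
    -- Polarization of the diagonal identity `hq`.
    have h1 := hq (x + y)
    have h2 := hq x
    have h3 := hq y
    have hs := M.form_symm.eq (e.toLinearEquiv.symm x) (e.toLinearEquiv.symm y)
    simp only [map_add, LinearMap.add_apply, Fin.sum_univ_four, Pi.add_apply] at h1 h2 h3 hs ⊢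
    linarith
  simp only [Module.Basis.reindex_apply, Equiv.symm_symm, Module.Basis.map_apply,
    Pi.basisFun_apply]
  rw [hform]
  by_cases hij : i = j
  · subst hij
    simp [Pi.single_apply, hσ]
  · simp [Pi.single_apply, hij, Ne.symm hij]

end CurvatureModel

/-! ### Traces of J and J² on the null cone -/

namespace CurvatureModel
variable {V : Type*} [AddCommGroup V] [Module ℝ V]

open Module Filter Topology

section Basic

variable (M : CurvatureModel V)

theorem form_comm (x y : V) : M.form x y = M.form y x := by
  simpa using M.form_symm.eq x y

theorem A_antisymm' (x y z v : V) : M.A x y z v = -M.A x y v z := by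
  rw [M.A_pair_symm, M.A_antisymm, M.A_pair_symm]

theorem A_self_left (x z v : V) : M.A x x z v = 0 := by
  linarith [M.A_antisymm x x z v]

theorem A_self_right (x y z : V) : M.A x y z z = 0 := by
  linarith [M.A_antisymm' x y z z]

theorem A_reverse (x y z v : V) : M.A x y z v = M.A v z y x := by
  rw [M.A_pair_symm, M.A_antisymm, M.A_antisymm', neg_neg]

theorem ext_form {u v : V} (h : ∀ w, M.form u w = M.form v w) : u = v := by
  have := M.form_nondegenerate.1 (u - v) (fun w => by simp [h w])
  exact sub_eq_zero.1 this

theorem exists_null_dual {x : V} (hx : M.form x x = 0) (hx0 : x ≠ 0) :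
    ∃ z, M.form z z = 0 ∧ M.form x z = 1 := by
  obtain ⟨w, hw⟩ : ∃ w, M.form x w ≠ 0 := by
    by_contra! hc
    exact hx0 (M.form_nondegenerate.1 x hc)
  have h1 : M.form x ((M.form x w)⁻¹ • w) = 1 := by simp [hw]
  set u := (M.form x w)⁻¹ • w
  -- Subtracting a multiple of the null vector x corrects ⟨u, u⟩ to 0 without changing ⟨x, u⟩ = 1.
  refine ⟨u - (M.form u u / 2) • x, ?_, ?_⟩
  · simp [hx, h1, M.form_comm u x]
    ring
  · simp [hx, h1]

end Basic

variable [FiniteDimensional ℝ V] (M : CurvatureModel V)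

theorem form_jacobi (x y z : V) : M.form (M.jacobi x y) z = M.A y x x z := M.form_curv x x y z

theorem jacobi_smul (r : ℝ) (x : V) : M.jacobi (r • x) = r ^ 2 • M.jacobi x := by
  ext y
  refine M.ext_form fun w => ?_
  simp [form_jacobi]
  ring

theorem jacobi_add_smul (x z : V) (t : ℝ) :
    M.jacobi (x + t • z) = M.jacobi x + t • (M.curv x z + M.curv z x) + t ^ 2 • M.jacobi z := by
  ext y
  refine M.ext_form fun w => ?_
  simp [form_jacobi, form_curv]
  ring

/-- Over ℂ the trace is the sum of the dim V roots of the characteristic polynomial, each an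
eigenvalue. -/
theorem abs_trace_le_of_hasEigenvalue (f : End ℝ V) (B : ℝ)
    (h : ∀ μ : ℂ, End.HasEigenvalue (f.baseChange ℂ) μ → ‖μ‖ ≤ B) :
    |LinearMap.trace ℝ V f| ≤ finrank ℝ V * B := by
  have h1 : (algebraMap ℝ ℂ) (LinearMap.trace ℝ V f) = (f.baseChange ℂ).charpoly.roots.sum := by
    rw [← LinearMap.trace_baseChange, End.trace_eq_sum_roots_charpoly_of_splits]
    exact IsAlgClosed.splits _
  have h2 : |LinearMap.trace ℝ V f| = ‖(f.baseChange ℂ).charpoly.roots.sum‖ := by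
    rw [← h1]; simp
  have h3 : ((f.baseChange ℂ).charpoly.roots).card = finrank ℝ V := by
    rw [← (IsAlgClosed.splits (f.baseChange ℂ).charpoly).natDegree_eq_card_roots,
      LinearMap.charpoly_natDegree, finrank_baseChange]
  rw [h2, ← h3]
  refine (norm_multiset_sum_le _).trans ?_
  refine (Multiset.sum_le_card_nsmul _ B ?_).trans (by simp)
  intro y hy
  obtain ⟨μ, hμ, rfl⟩ := Multiset.mem_map.1 hy
  exact h μ ((End.hasEigenvalue_iff_isRoot_charpoly _ _).2 (Polynomial.isRoot_of_mem_roots hμ))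

theorem abs_trace_sq_le_of_hasEigenvalue (f : End ℝ V) (B : ℝ)
    (h : ∀ μ : ℂ, End.HasEigenvalue (f.baseChange ℂ) μ → ‖μ‖ ≤ B) :
    |LinearMap.trace ℝ V (f * f)| ≤ finrank ℝ V * B ^ 2 := by
  refine abs_trace_le_of_hasEigenvalue _ _ fun μ hμ => ?_
  rw [LinearMap.baseChange_mul, ← pow_two, End.hasEigenvalue_iff_mem_spectrum,
    spectrum.map_pow_of_pos _ two_pos] at hμ
  obtain ⟨ν, hν, rfl⟩ := hμ
  have := h ν (End.hasEigenvalue_iff_mem_spectrum.2 hν)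
  simp only [norm_pow]
  gcongr

/-- The condition controls the set of eigenvalues but not their multiplicities, so a uniform bound
on the traces is extracted instead of their constancy; a bound is all that is used later. -/
theorem OssermanOn.exists_trace_bound {M : CurvatureModel V} {S : Set V} (h : M.OssermanOn S) :
    ∃ B : ℝ, ∀ x ∈ S, |LinearMap.trace ℝ V (M.jacobi x)| ≤ B ∧
      |LinearMap.trace ℝ V (M.jacobi x * M.jacobi x)| ≤ B := by
  rcases S.eq_empty_or_nonempty with rfl | ⟨x₀, hx₀⟩
  · exact ⟨0, by simp⟩
  have hfin : (M.jacobiEigenvalues x₀).Finite := by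
    refine ((M.jacobi x₀).baseChange ℂ).charpoly.roots.toFinset.finite_toSet.subset ?_
    intro μ hμ
    have h := (End.hasEigenvalue_iff_isRoot_charpoly _ _).1 hμ
    simpa [LinearMap.charpoly_monic _ |>.ne_zero] using h
  obtain ⟨B, hB⟩ := (hfin.image (‖·‖)).bddAbove
  refine ⟨max (finrank ℝ V * B) (finrank ℝ V * B ^ 2), fun x hx => ?_⟩
  have hle : ∀ μ : ℂ, End.HasEigenvalue ((M.jacobi x).baseChange ℂ) μ → ‖μ‖ ≤ B := by
    intro μ hμ
    have : μ ∈ M.jacobiEigenvalues x₀ := by rw [h x₀ hx₀ x hx]; exact hμ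
    exact hB ⟨μ, this, rfl⟩
  exact ⟨(abs_trace_le_of_hasEigenvalue _ _ hle).trans (le_max_left _ _),
    (abs_trace_sq_le_of_hasEigenvalue _ _ hle).trans (le_max_right _ _)⟩

/-- The traces of `J(x)` and `J(x)²` vanish on the null cone. -/
def NullTraceFree : Prop :=
  ∀ x, M.form x x = 0 → LinearMap.trace ℝ V (M.jacobi x) = 0 ∧
    LinearMap.trace ℝ V (M.jacobi x * M.jacobi x) = 0

theorem NullOsserman.nullTraceFree {M : CurvatureModel V} (h : M.NullOsserman) :
    M.NullTraceFree := by
  obtain ⟨B, hB⟩ := OssermanOn.exists_trace_bound h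
  -- The null cone is closed under scaling, so a trace of positive degree is either zero or
  -- unbounded.
  have key : ∀ a : ℝ, (∀ s : ℝ, 0 < s → |s * a| ≤ B) → a = 0 := by
    intro a ha
    by_contra hne
    have hpos : 0 < |a| := abs_pos.2 hne
    have h1 := ha ((|B| + 1) / |a|) (by positivity)
    rw [abs_mul, abs_div, abs_abs, div_mul_cancel₀ _ hpos.ne', abs_of_pos (by positivity)] at h1
    linarith [le_abs_self B]
  intro x hx
  rcases eq_or_ne x 0 with rfl | hx0
  · have : M.jacobi 0 = 0 := by simpa using M.jacobi_smul 0 0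
    simp [this]
  have hmem : ∀ r : ℝ, r ≠ 0 → r • x ∈ M.nullCone := fun r hr =>
    ⟨smul_ne_zero hr hx0, by simp [hx]⟩
  constructor
  · refine key _ fun s hs => ?_
    have h1 := (hB (√s • x) (hmem _ (Real.sqrt_pos.2 hs).ne')).1
    rw [jacobi_smul, Real.sq_sqrt hs.le] at h1
    simpa using h1
  · refine key _ fun s hs => ?_
    -- J² has degree 4 in x, so the fourth root of s scales its trace by s.
    have h1 := (hB (√(√s) • x) (hmem _ (Real.sqrt_pos.2 (Real.sqrt_pos.2 hs)).ne')).2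
    rw [jacobi_smul, Real.sq_sqrt (Real.sqrt_nonneg s), smul_mul_smul_comm,
      Real.mul_self_sqrt hs.le] at h1
    simpa using h1

theorem eq_zero_of_abs_le_mul {p : ℝ → ℝ} (hp : Continuous p) {B : ℝ} {n : ℕ} (hn : n ≠ 0)
    (h : ∀ r, r ≠ 0 → |p r| ≤ r ^ n * B) : p 0 = 0 := by
  have h1 : Tendsto p (𝓝[≠] 0) (𝓝 (p 0)) := hp.continuousAt.tendsto.mono_left nhdsWithin_le_nhds
  have h2 : Tendsto (fun r : ℝ => r ^ n * B) (𝓝[≠] 0) (𝓝 0) := by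
    have : Continuous fun r : ℝ => r ^ n * B := by fun_prop
    simpa [hn] using this.continuousAt.tendsto.mono_left (nhdsWithin_le_nhds (a := 0) (s := {0}ᶜ))
  have h3 : Tendsto p (𝓝[≠] 0) (𝓝 0) :=
    squeeze_zero_norm' (by
      filter_upwards [self_mem_nhdsWithin] with r hr
      exact h r hr) h2
  exact tendsto_nhds_unique h1 h3

/-- The vectors x + (εr²/2)z, with z null and ⟨x, z⟩ = 1, have square εr² and tend to x as r → 0.
They are r times vectors of square ε, so tr J and tr J² on them are O(r²) and O(r⁴). -/
theorem nullTraceFree_of_ossermanOn_unit {ε : ℝ}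
    (h : M.OssermanOn {x | M.form x x = ε}) : M.NullTraceFree := by
  obtain ⟨B, hB⟩ := h.exists_trace_bound
  intro x hx
  rcases eq_or_ne x 0 with rfl | hx0
  · have : M.jacobi 0 = 0 := by simpa using M.jacobi_smul 0 0
    simp [this]
  obtain ⟨z, hz, hxz⟩ := M.exists_null_dual hx hx0
  have hmem : ∀ r : ℝ, r ≠ 0 → r⁻¹ • (x + (ε * r ^ 2 / 2) • z) ∈ {x | M.form x x = ε} := by
    intro r hr
    simp [hx, hz, hxz, M.form_comm z x]
    field_simp
    ring
  have hJ : ∀ r : ℝ, r ≠ 0 → M.jacobi (x + (ε * r ^ 2 / 2) • z) =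
      r ^ 2 • M.jacobi (r⁻¹ • (x + (ε * r ^ 2 / 2) • z)) := by
    intro r hr
    rw [M.jacobi_smul r⁻¹, smul_smul, ← mul_pow, mul_inv_cancel₀ hr, one_pow, one_smul]
  constructor
  · have := eq_zero_of_abs_le_mul (p := fun r => LinearMap.trace ℝ V
      (M.jacobi (x + (ε * r ^ 2 / 2) • z))) (B := B) (n := 2) ?_ two_ne_zero ?_
    · simpa using this
    · simp only [jacobi_add_smul, map_add, map_smul, smul_eq_mul]
      fun_prop
    · intro r hr
      rw [hJ r hr, map_smul, smul_eq_mul, abs_mul, abs_of_nonneg (sq_nonneg r)]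
      exact mul_le_mul_of_nonneg_left (hB _ (hmem r hr)).1 (sq_nonneg r)
  · have := eq_zero_of_abs_le_mul (p := fun r => LinearMap.trace ℝ V
      (M.jacobi (x + (ε * r ^ 2 / 2) • z) * M.jacobi (x + (ε * r ^ 2 / 2) • z)))
      (B := B) (n := 4) ?_ four_ne_zero ?_
    · simpa using this
    · simp only [jacobi_add_smul, add_mul, mul_add, smul_mul_assoc, mul_smul_comm, map_add,
        map_smul, smul_eq_mul]
      fun_prop
    · intro r hr
      rw [hJ r hr, smul_mul_smul_comm, map_smul, smul_eq_mul, abs_mul,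
        abs_of_nonneg (mul_self_nonneg _), show r ^ 2 * r ^ 2 = r ^ 4 by ring]
      exact mul_le_mul_of_nonneg_left (hB _ (hmem r hr)).2 (by positivity)

end CurvatureModel

/-! ### Curvature, traces and rotations in a frame -/

namespace CurvatureModel
variable {V : Type*} [AddCommGroup V] [Module ℝ V]

open Module

theorem frameSign_mul_self (i : Fin 4) : frameSign i * frameSign i = 1 := by
  fin_cases i <;> simp [frameSign]

section Frame

variable {M : CurvatureModel V} {b : Basis (Fin 4) ℝ V}

theorem IsFrame.coord_eq (hb : M.IsFrame b) (v : V) (i : Fin 4) :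
    b.repr v i = frameSign i * M.form v (b i) := by
  conv_rhs => rw [← b.sum_repr v]
  simp only [map_sum, map_smul, LinearMap.sum_apply, LinearMap.smul_apply, hb _ i, smul_eq_mul]
  simp only [mul_ite, mul_zero, Finset.sum_ite_eq', Finset.mem_univ, if_true]
  rw [mul_left_comm, frameSign_mul_self, mul_one]

theorem IsFrame.trace_eq (hb : M.IsFrame b) (f : End ℝ V) :
    LinearMap.trace ℝ V f = ∑ i, frameSign i * M.form (f (b i)) (b i) := by
  rw [LinearMap.trace_eq_matrix_trace ℝ b, Matrix.trace]
  simp [LinearMap.toMatrix_apply, hb.coord_eq]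

theorem IsFrame.trace_mul_eq (hb : M.IsFrame b) (f g : End ℝ V) :
    LinearMap.trace ℝ V (f * g) = ∑ i, ∑ j, frameSign i * frameSign j *
      (M.form (f (b j)) (b i) * M.form (g (b i)) (b j)) := by
  rw [LinearMap.trace_eq_matrix_trace ℝ b, LinearMap.toMatrix_mul, Matrix.trace]
  simp only [Matrix.diag_apply, Matrix.mul_apply, LinearMap.toMatrix_apply, hb.coord_eq]
  exact Finset.sum_congr rfl fun i _ => Finset.sum_congr rfl fun j _ => by ring

variable [FiniteDimensional ℝ V]

theorem IsFrame.ricci_eq (hb : M.IsFrame b) (x y : V) :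
    M.ricci x y = ∑ i, frameSign i * M.A (b i) x y (b i) := by
  change LinearMap.trace ℝ V (M.curv x y) = _
  simp [hb.trace_eq, form_curv]

theorem IsFrame.weyl_eq (hb : M.IsFrame b) {c : ℝ}
    (hc : ∀ x y, M.ricci x y = c * M.form x y) (x y z v : V) :
    M.weyl x y z v =
      M.A x y z v - c / 3 * (M.form y z * M.form x v - M.form x z * M.form y v) := by
  have : M.scalar = 4 * c := by
    rw [scalar, hb.trace_eq]
    simp only [form_raise, hc, hb _ _, Fin.sum_univ_four, frameSign]
    simp
    ring
  rw [weyl, this]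
  simp only [hc]
  ring

end Frame

theorem exists_basis_of_gram {M : CurvatureModel V} (hdim : finrank ℝ V = 4) (v : Fin 4 → V)
    (hv : ∀ i j, M.form (v i) (v j) = if i = j then frameSign i else 0) :
    ∃ b : Basis (Fin 4) ℝ V, M.IsFrame b ∧ ∀ i, b i = v i := by
  have hli : LinearIndependent ℝ v := by
    rw [Fintype.linearIndependent_iff]
    intro g hg j
    have h1 : M.form (∑ i, g i • v i) (v j) = 0 := by rw [hg]; simp
    simp only [map_sum, map_smul, LinearMap.sum_apply, LinearMap.smul_apply, hv _ j,
      smul_eq_mul] at h1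
    simp only [mul_ite, mul_zero, Finset.sum_ite_eq', Finset.mem_univ, if_true] at h1
    have h2 := frameSign_mul_self j
    rcases mul_eq_zero.1 h1 with h | h
    · exact h
    · rw [h] at h2; norm_num at h2
  refine ⟨basisOfLinearIndependentOfCardEqFinrank hli (by simp [hdim]), fun i j => ?_, fun i => ?_⟩
  · simp [hv]
  · simp

theorem IsFrame.exists_rotate {M : CurvatureModel V} {b : Basis (Fin 4) ℝ V} (hb : M.IsFrame b)
    (θ ψ : ℝ) : ∃ b' : Basis (Fin 4) ℝ V,
    M.IsFrame b' ∧ b' 0 = Real.cos θ • b 0 + Real.sin θ • b 1 ∧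
      b' 1 = -Real.sin θ • b 0 + Real.cos θ • b 1 ∧
      b' 2 = Real.cos ψ • b 2 + Real.sin ψ • b 3 ∧
      b' 3 = -Real.sin ψ • b 2 + Real.cos ψ • b 3 := by
  obtain ⟨b', hb', h⟩ := exists_basis_of_gram (M := M) (by simpa using finrank_eq_card_basis b)
    ![Real.cos θ • b 0 + Real.sin θ • b 1, -Real.sin θ • b 0 + Real.cos θ • b 1,
      Real.cos ψ • b 2 + Real.sin ψ • b 3, -Real.sin ψ • b 2 + Real.cos ψ • b 3] (by
    intro i j
    have h1 := Real.sin_sq_add_cos_sq θ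
    have h2 := Real.sin_sq_add_cos_sq ψ
    fin_cases i <;> fin_cases j <;> simp [hb _ _, frameSign] <;> linarith)
  exact ⟨b', hb', by simp [h], by simp [h], by simp [h], by simp [h]⟩

section Expansion

variable (M : CurvatureModel V)

theorem A_lincomb_left (b : Fin 4 → V) (x₀ x₁ x₂ x₃ y₀ y₁ y₂ y₃ : ℝ) (z w : V) :
    M.A (x₀ • b 0 + x₁ • b 1 + x₂ • b 2 + x₃ • b 3) (y₀ • b 0 + y₁ • b 1 + y₂ • b 2 + y₃ • b 3) z w
      = (x₀ * y₁ - x₁ * y₀) * M.A (b 0) (b 1) z w + (x₀ * y₂ - x₂ * y₀) * M.A (b 0) (b 2) z w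
      + (x₀ * y₃ - x₃ * y₀) * M.A (b 0) (b 3) z w + (x₁ * y₂ - x₂ * y₁) * M.A (b 1) (b 2) z w
      + (x₁ * y₃ - x₃ * y₁) * M.A (b 1) (b 3) z w + (x₂ * y₃ - x₃ * y₂) * M.A (b 2) (b 3) z w := by
  simp only [map_add, map_smul, LinearMap.add_apply, LinearMap.smul_apply, smul_eq_mul,
    A_self_left]
  rw [M.A_antisymm (b 1) (b 0), M.A_antisymm (b 2) (b 0), M.A_antisymm (b 3) (b 0),
    M.A_antisymm (b 2) (b 1), M.A_antisymm (b 3) (b 1), M.A_antisymm (b 3) (b 2)]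
  ring

theorem A_lincomb_right (b : Fin 4 → V) (x₀ x₁ x₂ x₃ y₀ y₁ y₂ y₃ : ℝ) (z w : V) :
    M.A z w (x₀ • b 0 + x₁ • b 1 + x₂ • b 2 + x₃ • b 3) (y₀ • b 0 + y₁ • b 1 + y₂ • b 2 + y₃ • b 3)
      = (x₀ * y₁ - x₁ * y₀) * M.A z w (b 0) (b 1) + (x₀ * y₂ - x₂ * y₀) * M.A z w (b 0) (b 2)
      + (x₀ * y₃ - x₃ * y₀) * M.A z w (b 0) (b 3) + (x₁ * y₂ - x₂ * y₁) * M.A z w (b 1) (b 2)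
      + (x₁ * y₃ - x₃ * y₁) * M.A z w (b 1) (b 3) + (x₂ * y₃ - x₃ * y₂) * M.A z w (b 2) (b 3) := by
  rw [M.A_pair_symm, A_lincomb_left]
  simp only [M.A_pair_symm z w]

/-- Rewriting rules that bring the components of `A` into the form `A i j k l` with `i < j`,
`k < l` and `(i, j) ≤ (k, l)`. -/
theorem A_normalize (b : Fin 4 → V) :
    (∀ z v, M.A (b 1) (b 0) z v = -M.A (b 0) (b 1) z v) ∧
    (∀ z v, M.A (b 2) (b 0) z v = -M.A (b 0) (b 2) z v) ∧
    (∀ z v, M.A (b 3) (b 0) z v = -M.A (b 0) (b 3) z v) ∧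
    (∀ z v, M.A (b 2) (b 1) z v = -M.A (b 1) (b 2) z v) ∧
    (∀ z v, M.A (b 3) (b 1) z v = -M.A (b 1) (b 3) z v) ∧
    (∀ z v, M.A (b 3) (b 2) z v = -M.A (b 2) (b 3) z v) ∧
    (∀ x y, M.A x y (b 1) (b 0) = -M.A x y (b 0) (b 1)) ∧
    (∀ x y, M.A x y (b 2) (b 0) = -M.A x y (b 0) (b 2)) ∧
    (∀ x y, M.A x y (b 3) (b 0) = -M.A x y (b 0) (b 3)) ∧
    (∀ x y, M.A x y (b 2) (b 1) = -M.A x y (b 1) (b 2)) ∧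
    (∀ x y, M.A x y (b 3) (b 1) = -M.A x y (b 1) (b 3)) ∧
    (∀ x y, M.A x y (b 3) (b 2) = -M.A x y (b 2) (b 3)) ∧
    M.A (b 0) (b 2) (b 0) (b 1) =
      M.A (b 0) (b 1) (b 0) (b 2) ∧
    M.A (b 0) (b 3) (b 0) (b 1) =
      M.A (b 0) (b 1) (b 0) (b 3) ∧
    M.A (b 0) (b 3) (b 0) (b 2) =
      M.A (b 0) (b 2) (b 0) (b 3) ∧
    M.A (b 1) (b 2) (b 0) (b 1) =
      M.A (b 0) (b 1) (b 1) (b 2) ∧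
    M.A (b 1) (b 2) (b 0) (b 2) =
      M.A (b 0) (b 2) (b 1) (b 2) ∧
    M.A (b 1) (b 2) (b 0) (b 3) =
      M.A (b 0) (b 3) (b 1) (b 2) ∧
    M.A (b 1) (b 3) (b 0) (b 1) =
      M.A (b 0) (b 1) (b 1) (b 3) ∧
    M.A (b 1) (b 3) (b 0) (b 2) =
      M.A (b 0) (b 2) (b 1) (b 3) ∧
    M.A (b 1) (b 3) (b 0) (b 3) =
      M.A (b 0) (b 3) (b 1) (b 3) ∧
    M.A (b 1) (b 3) (b 1) (b 2) =
      M.A (b 1) (b 2) (b 1) (b 3) ∧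
    M.A (b 2) (b 3) (b 0) (b 1) =
      M.A (b 0) (b 1) (b 2) (b 3) ∧
    M.A (b 2) (b 3) (b 0) (b 2) =
      M.A (b 0) (b 2) (b 2) (b 3) ∧
    M.A (b 2) (b 3) (b 0) (b 3) =
      M.A (b 0) (b 3) (b 2) (b 3) ∧
    M.A (b 2) (b 3) (b 1) (b 2) =
      M.A (b 1) (b 2) (b 2) (b 3) ∧
    M.A (b 2) (b 3) (b 1) (b 3) =
      M.A (b 1) (b 3) (b 2) (b 3) := by
  refine ⟨?_, ?_, ?_, ?_, ?_, ?_, ?_, ?_, ?_, ?_, ?_, ?_, ?_, ?_, ?_, ?_, ?_, ?_, ?_, ?_, ?_, ?_,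
    ?_, ?_, ?_, ?_, ?_⟩
  iterate 6 exact fun z v => M.A_antisymm _ _ z v
  iterate 6 exact fun x y => M.A_antisymm' x y _ _
  all_goals exact M.A_pair_symm _ _ _ _

end Expansion

/-! ### Two-forms and the Weyl operator in components -/

theorem sum_indexPairs {N : Type*} [AddCommMonoid N] (f : Fin 4 × Fin 4 → N) :
    ∑ p ∈ indexPairs, f p =
      f (0, 1) + f (0, 2) + f (0, 3) + f (1, 2) + f (1, 3) + f (2, 3) := by
  have hp : indexPairs = {(0, 1), (0, 2), (0, 3), (1, 2), (1, 3), (2, 3)} := by decide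
  rw [hp]
  simp [add_assoc]

theorem component_swap (b : Basis (Fin 4) ℝ V) (k l : Fin 4) (θ : TwoForm V) :
    component b l k θ = -component b k l θ := by
  have h := θ.map_swap ![b k, b l] (show (0 : Fin 2) ≠ 1 by decide)
  have e : (![b k, b l] ∘ ⇑(Equiv.swap (0 : Fin 2) 1)) = ![b l, b k] := by
    ext i; fin_cases i <;> simp
  rw [e] at h
  exact h

theorem twoForm_ext (b : Basis (Fin 4) ℝ V) {θ η : TwoForm V}
    (h : ∀ k l : Fin 4, k < l → component b k l θ = component b k l η) : θ = η := by
  refine Basis.ext_alternating b fun v hv => ?_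
  have hne : v 0 ≠ v 1 := fun h => absurd (hv h) (by decide)
  have e : (fun i => b (v i)) = ![b (v 0), b (v 1)] := by
    ext i; fin_cases i <;> simp
  rw [e]
  rcases lt_or_gt_of_ne hne with h' | h'
  · exact h _ _ h'
  · have h1 := h _ _ h'
    have h2 := component_swap b (v 1) (v 0) θ
    have h3 := component_swap b (v 1) (v 0) η
    rw [h1, ← h3] at h2
    exact h2

theorem component_dualWedge (b : Basis (Fin 4) ℝ V) (i j k l : Fin 4) :
    component b k l (dualWedge b i j) =
      (if k = i then 1 else 0) * (if l = j then 1 else 0)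
        - (if k = j then 1 else 0) * (if l = i then 1 else 0) := by
  change dualWedge b i j ![b k, b l] = _
  rw [dualWedge_apply]
  simp [Finsupp.single_apply]

theorem mem_antiSelfDualForms_iff (b : Basis (Fin 4) ℝ V) (θ : TwoForm V) :
    θ ∈ antiSelfDualForms b ↔ component b 2 3 θ = -component b 0 1 θ ∧
      component b 1 3 θ = -component b 0 2 θ ∧ component b 1 2 θ = component b 0 3 θ := by
  rw [antiSelfDualForms, LinearMap.mem_ker]
  have hc : ∀ k l, component b k l
      ((hodge b + LinearMap.id : TwoForm V →ₗ[ℝ] TwoForm V) θ) = component b k l θ +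
      (component b 0 1 θ * component b k l (dualWedge b 2 3)
      + component b 0 2 θ * component b k l (dualWedge b 1 3)
      - component b 0 3 θ * component b k l (dualWedge b 1 2)
      - component b 1 2 θ * component b k l (dualWedge b 0 3)
      + component b 1 3 θ * component b k l (dualWedge b 0 2)
      + component b 2 3 θ * component b k l (dualWedge b 0 1)) := by
    intro k l
    simp only [hodge, LinearMap.add_apply, LinearMap.sub_apply, LinearMap.smulRight_apply,
      LinearMap.id_apply, map_add, map_sub, map_smul, smul_eq_mul]
    ring
  simp only [component_dualWedge] at hc
  constructor
  · intro h
    have h1 := hc 2 3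
    have h2 := hc 1 3
    have h3 := hc 1 2
    rw [h, map_zero] at h1 h2 h3
    simp at h1 h2 h3
    refine ⟨?_, ?_, ?_⟩ <;> linarith
  · rintro ⟨h1, h2, h3⟩
    refine twoForm_ext b fun k l hkl => ?_
    rw [hc, map_zero]
    fin_cases k <;> fin_cases l <;> simp at hkl <;> simp [h1, h2, h3]

section WeylOperator

variable [FiniteDimensional ℝ V] (M : CurvatureModel V) (b : Basis (Fin 4) ℝ V)

theorem component_weylOperator {k l : Fin 4} (hkl : k < l) (θ : TwoForm V) :
    component b k l (M.weylOperator b θ) = ∑ p ∈ indexPairs, frameSign p.1 * frameSign p.2 *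
      M.weyl (b k) (b l) (b p.1) (b p.2) * component b p.1 p.2 θ := by
  have key : ∀ q ∈ indexPairs, component b k l (dualWedge b q.1 q.2) =
      if q = (k, l) then 1 else 0 := by
    rintro ⟨i, j⟩ hq
    have hij : i < j := by simpa [indexPairs] using hq
    have hne : ¬(k = j ∧ l = i) := by
      rintro ⟨rfl, rfl⟩
      exact lt_asymm hij hkl
    rw [component_dualWedge, ite_zero_mul_ite_zero, ite_zero_mul_ite_zero, if_neg hne]
    simp [eq_comm]
  rw [weylOperator, LinearMap.sum_apply, map_sum]
  simp only [LinearMap.smulRight_apply, map_smul, smul_eq_mul]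
  rw [Finset.sum_congr rfl fun q hq => by rw [key q hq]]
  simp [indexPairs, hkl]

/-- The three equations for each k < l test the operator on the basis e⁰¹ - e²³, e⁰² - e¹³, e⁰³ +
e¹² of Λ⁻. -/
theorem domRestrict_weylOperator_eq_zero_iff :
    (M.weylOperator b).domRestrict (antiSelfDualForms b) = 0 ↔ ∀ k l : Fin 4, k < l →
      M.weyl (b k) (b l) (b 0) (b 1) = M.weyl (b k) (b l) (b 2) (b 3) ∧
      M.weyl (b k) (b l) (b 0) (b 2) = M.weyl (b k) (b l) (b 1) (b 3) ∧
      M.weyl (b k) (b l) (b 0) (b 3) = -M.weyl (b k) (b l) (b 1) (b 2) := by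
  constructor
  · intro h k l hkl
    have hz : ∀ θ ∈ antiSelfDualForms b, component b k l (M.weylOperator b θ) = 0 := by
      intro θ hθ
      have := LinearMap.congr_fun h ⟨θ, hθ⟩
      rw [LinearMap.domRestrict_apply] at this
      simp [this]
    have h1 := hz (dualWedge b 0 1 - dualWedge b 2 3) (by
      rw [mem_antiSelfDualForms_iff]; simp [component_dualWedge])
    have h2 := hz (dualWedge b 0 2 - dualWedge b 1 3) (by
      rw [mem_antiSelfDualForms_iff]; simp [component_dualWedge])
    have h3 := hz (dualWedge b 0 3 + dualWedge b 1 2) (by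
      rw [mem_antiSelfDualForms_iff]; simp [component_dualWedge])
    rw [component_weylOperator M b hkl, sum_indexPairs] at h1 h2 h3
    simp [component_dualWedge, frameSign] at h1 h2 h3
    refine ⟨?_, ?_, ?_⟩ <;> linarith
  · intro h
    refine LinearMap.ext fun ⟨θ, hθ⟩ => ?_
    rw [mem_antiSelfDualForms_iff] at hθ
    obtain ⟨e1, e2, e3⟩ := hθ
    rw [LinearMap.domRestrict_apply]
    refine twoForm_ext b fun k l hkl => ?_
    obtain ⟨h1, h2, h3⟩ := h k l hkl
    rw [component_weylOperator M b hkl, sum_indexPairs, e1, e2, e3]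
    simp [frameSign, h1, h2, h3]

end WeylOperator
end CurvatureModel

/-! ### Consequences of the vanishing null traces -/

namespace CurvatureModel
variable {V : Type*} [AddCommGroup V] [Module ℝ V] [FiniteDimensional ℝ V]
variable {M : CurvatureModel V} {b : Module.Basis (Fin 4) ℝ V}

open Module

theorem IsFrame.ricci_comm (hb : M.IsFrame b) (x y : V) : M.ricci x y = M.ricci y x := by
  rw [hb.ricci_eq, hb.ricci_eq]
  exact Finset.sum_congr rfl fun i _ => by rw [M.A_reverse]

/-- A quadratic form that vanishes on the null cone of an indefinite form is a multiple of it;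
finitely many null vectors suffice to see this. -/
theorem IsFrame.isEinstein_of_ricci_null (hb : M.IsFrame b)
    (h : ∀ x, M.form x x = 0 → M.ricci x x = 0) : M.IsEinstein := by
  have hform : ∀ x₀ x₁ x₂ x₃ : ℝ,
      M.form (x₀ • b 0 + x₁ • b 1 + x₂ • b 2 + x₃ • b 3)
        (x₀ • b 0 + x₁ • b 1 + x₂ • b 2 + x₃ • b 3) = -x₀ ^ 2 - x₁ ^ 2 + x₂ ^ 2 + x₃ ^ 2 := by
    intro x₀ x₁ x₂ x₃
    simp [hb _ _, frameSign]
    ring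
  have hquad : ∀ x₀ x₁ x₂ x₃ : ℝ, -x₀ ^ 2 - x₁ ^ 2 + x₂ ^ 2 + x₃ ^ 2 = 0 →
      x₀ ^ 2 * M.ricci (b 0) (b 0) + x₁ ^ 2 * M.ricci (b 1) (b 1) + x₂ ^ 2 * M.ricci (b 2) (b 2)
      + x₃ ^ 2 * M.ricci (b 3) (b 3) + 2 * x₀ * x₁ * M.ricci (b 0) (b 1)
      + 2 * x₀ * x₂ * M.ricci (b 0) (b 2) + 2 * x₀ * x₃ * M.ricci (b 0) (b 3)
      + 2 * x₁ * x₂ * M.ricci (b 1) (b 2) + 2 * x₁ * x₃ * M.ricci (b 1) (b 3)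
      + 2 * x₂ * x₃ * M.ricci (b 2) (b 3) = 0 := by
    intro x₀ x₁ x₂ x₃ hx
    have h1 := h (x₀ • b 0 + x₁ • b 1 + x₂ • b 2 + x₃ • b 3) (by rw [hform, hx])
    simp only [map_add, map_smul, LinearMap.add_apply, LinearMap.smul_apply, smul_eq_mul,
      hb.ricci_comm (b 1) (b 0), hb.ricci_comm (b 2) (b 0), hb.ricci_comm (b 3) (b 0),
      hb.ricci_comm (b 2) (b 1), hb.ricci_comm (b 3) (b 1), hb.ricci_comm (b 3) (b 2)] at h1
    linear_combination h1
  have e1 := hquad 1 0 1 0 (by norm_num)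
  have e2 := hquad 1 0 (-1) 0 (by norm_num)
  have e3 := hquad 1 0 0 1 (by norm_num)
  have e4 := hquad 1 0 0 (-1) (by norm_num)
  have e5 := hquad 0 1 1 0 (by norm_num)
  have e6 := hquad 0 1 (-1) 0 (by norm_num)
  have e7 := hquad 0 1 0 1 (by norm_num)
  have e8 := hquad 0 1 0 (-1) (by norm_num)
  -- The Pythagorean vectors reach ρ₀₁ and ρ₂₃, which the null vectors with two non-zero coordinates
  -- miss.
  have e9 := hquad 3 4 5 0 (by norm_num)
  have e10 := hquad 5 0 3 4 (by norm_num)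
  have key : M.ricci = M.ricci (b 2) (b 2) • M.form := by
    refine b.ext fun i => b.ext fun j => ?_
    rw [LinearMap.smul_apply, LinearMap.smul_apply, hb i j]
    fin_cases i <;> fin_cases j <;> simp [frameSign] <;>
      (try simp only [hb.ricci_comm (b 1) (b 0), hb.ricci_comm (b 2) (b 0), hb.ricci_comm (b 3) (b 0),
      hb.ricci_comm (b 2) (b 1), hb.ricci_comm (b 3) (b 1), hb.ricci_comm (b 3) (b 2)]) <;>
      linarith
  exact ⟨M.ricci (b 2) (b 2), fun x y => by
    simpa using LinearMap.congr_fun₂ key x y⟩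

/-- For x = e₀ + e₂ the plane x^⊥/x is spanned by e₁ and e₃, with null directions e₁ ± e₃. A
symmetric operator on a plane of signature (1,1) that is trace-free with trace-free square has a
quadratic form vanishing on one of the two null directions. -/
theorem IsFrame.mul_eq_zero_of_nullTraceFree (hb : M.IsFrame b) (h : M.NullTraceFree) :
    M.A (b 0 + b 2) (b 1 + b 3) (b 0 + b 2) (b 1 + b 3) *
      M.A (b 0 + b 2) (b 1 - b 3) (b 0 + b 2) (b 1 - b 3) = 0 := by
  obtain ⟨h1, h2⟩ := h (b 0 + b 2) (by simp [hb _ _, frameSign])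
  rw [hb.trace_eq] at h1
  rw [hb.trace_mul_eq] at h2
  simp only [form_jacobi] at h1 h2
  have hu : ∀ u, M.A (b 0 + b 2) u (b 0 + b 2) u = -M.A u (b 0 + b 2) (b 0 + b 2) u :=
    fun u => M.A_antisymm _ _ _ _
  rw [hu, hu]
  generalize hx : b 0 + b 2 = x at *
  -- This is J(x)x = 0; it makes the contributions of e₀ and e₂ to both traces cancel.
  have hz : ∀ w, M.A (b 2) x x w = -M.A (b 0) x x w := by
    intro w
    have h0 := M.A_self_left x x w
    nth_rewrite 1 [← hx] at h0
    simp only [map_add, LinearMap.add_apply] at h0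
    linarith
  have hs : ∀ y z, M.A y x x z = M.A z x x y := fun y z => M.A_reverse y x x z
  simp only [Fin.sum_univ_four, hz, hs _ (b 2), hs (b 1) (b 0), hs (b 3) (b 0),
    hs (b 3) (b 1)] at h1 h2
  simp [frameSign] at h1 h2
  have hsub : ∀ w, M.A (b 1 - b 3) x x w = M.A (b 1) x x w - M.A (b 3) x x w := fun w => by
    rw [hs, map_sub, hs w, hs w]
  simp only [map_add, map_sub, hsub, LinearMap.add_apply, hs (b 3) (b 1)]
  linear_combination 2 * h2 -
    (M.A (b 3) x x (b 3) - M.A (b 1) x x (b 1)) * h1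

/-- The value of the curvature on the bivector
`(e₀₁ + e₂₃) + sin α (e₀₂ + e₁₃) + cos α (e₀₃ - e₁₂)` of a null plane. -/
noncomputable def selfDualQuartic (M : CurvatureModel V) (b : Basis (Fin 4) ℝ V) (α : ℝ) : ℝ :=
  (M.A (b 0) (b 1) (b 0) (b 1) + 2 * M.A (b 0) (b 1) (b 2) (b 3) + M.A (b 2) (b 3) (b 2) (b 3))
  + Real.sin α ^ 2 * (M.A (b 0) (b 2) (b 0) (b 2) + 2 * M.A (b 0) (b 2) (b 1) (b 3)
      + M.A (b 1) (b 3) (b 1) (b 3))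
  + Real.cos α ^ 2 * (M.A (b 0) (b 3) (b 0) (b 3) - 2 * M.A (b 0) (b 3) (b 1) (b 2)
      + M.A (b 1) (b 2) (b 1) (b 2))
  + 2 * Real.sin α * (M.A (b 0) (b 1) (b 0) (b 2) + M.A (b 0) (b 1) (b 1) (b 3)
      + M.A (b 0) (b 2) (b 2) (b 3) + M.A (b 1) (b 3) (b 2) (b 3))
  + 2 * Real.cos α * (M.A (b 0) (b 1) (b 0) (b 3) - M.A (b 0) (b 1) (b 1) (b 2)
      + M.A (b 0) (b 3) (b 2) (b 3) - M.A (b 1) (b 2) (b 2) (b 3))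
  + 2 * Real.sin α * Real.cos α * (M.A (b 0) (b 2) (b 0) (b 3) - M.A (b 0) (b 2) (b 1) (b 2)
      + M.A (b 0) (b 3) (b 1) (b 3) - M.A (b 1) (b 2) (b 1) (b 3))

/-- The value of the curvature on the bivector
`(e₀₁ - e₂₃) + sin β (e₀₂ - e₁₃) - cos β (e₀₃ + e₁₂)` of a null plane. -/
noncomputable def antiSelfDualQuartic (M : CurvatureModel V) (b : Basis (Fin 4) ℝ V) (β : ℝ) : ℝ :=
  (M.A (b 0) (b 1) (b 0) (b 1) - 2 * M.A (b 0) (b 1) (b 2) (b 3) + M.A (b 2) (b 3) (b 2) (b 3))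
  + Real.sin β ^ 2 * (M.A (b 0) (b 2) (b 0) (b 2) - 2 * M.A (b 0) (b 2) (b 1) (b 3)
      + M.A (b 1) (b 3) (b 1) (b 3))
  + Real.cos β ^ 2 * (M.A (b 0) (b 3) (b 0) (b 3) + 2 * M.A (b 0) (b 3) (b 1) (b 2)
      + M.A (b 1) (b 2) (b 1) (b 2))
  + 2 * Real.sin β * (M.A (b 0) (b 1) (b 0) (b 2) - M.A (b 0) (b 1) (b 1) (b 3)
      - M.A (b 0) (b 2) (b 2) (b 3) + M.A (b 1) (b 3) (b 2) (b 3))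
  - 2 * Real.cos β * (M.A (b 0) (b 1) (b 0) (b 3) + M.A (b 0) (b 1) (b 1) (b 2)
      - M.A (b 0) (b 3) (b 2) (b 3) - M.A (b 1) (b 2) (b 2) (b 3))
  - 2 * Real.sin β * Real.cos β * (M.A (b 0) (b 2) (b 0) (b 3) + M.A (b 0) (b 2) (b 1) (b 2)
      - M.A (b 0) (b 3) (b 1) (b 3) - M.A (b 1) (b 2) (b 1) (b 3))


/-- Rotating the timelike plane by θ and the spacelike plane by ψ turns the self-dual bivector x∧u
by α = θ - ψ and the anti-self-dual x∧v by β = θ + ψ. The two parameters are therefore independent.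
-/
theorem IsFrame.quartic_mul_eq_zero (hb : M.IsFrame b) (h : M.NullTraceFree) (α β : ℝ) :
    M.selfDualQuartic b α * M.antiSelfDualQuartic b β = 0 := by
  obtain ⟨b', hb', h0, h1, h2, h3⟩ := hb.exists_rotate ((α + β) / 2) ((β - α) / 2)
  have hmul := hb'.mul_eq_zero_of_nullTraceFree h
  set θ := (α + β) / 2 with hθ
  set ψ := (β - α) / 2 with hψ
  have hα : α = θ - ψ := by rw [hθ, hψ]; ring
  have hβ : β = θ + ψ := by rw [hθ, hψ]; ring
  have hx : b' 0 + b' 2 = Real.cos θ • b 0 + Real.sin θ • b 1 + Real.cos ψ • b 2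
      + Real.sin ψ • b 3 := by rw [h0, h2]; abel
  have hu : b' 1 + b' 3 = (-Real.sin θ) • b 0 + Real.cos θ • b 1 + (-Real.sin ψ) • b 2
      + Real.cos ψ • b 3 := by rw [h1, h3]; abel
  have hv : b' 1 - b' 3 = (-Real.sin θ) • b 0 + Real.cos θ • b 1 + Real.sin ψ • b 2
      + (-Real.cos ψ) • b 3 := by rw [h1, h3]; module
  have t1 := Real.sin_sq_add_cos_sq θ
  have t2 := Real.sin_sq_add_cos_sq ψ
  have s1 : M.A (b' 0 + b' 2) (b' 1 + b' 3) (b' 0 + b' 2) (b' 1 + b' 3) =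
      M.selfDualQuartic b α := by
    have hS : Real.sin α = Real.sin θ * Real.cos ψ - Real.cos θ * Real.sin ψ := by
      rw [hα, Real.sin_sub]
    have hC : Real.cos α = Real.cos θ * Real.cos ψ + Real.sin θ * Real.sin ψ := by
      rw [hα, Real.cos_sub]
    -- The `wij` are the Plücker coordinates of the plane spanned by x and u.
    have w01 : Real.cos θ * Real.cos θ - Real.sin θ * (-Real.sin θ) = 1 := by linarith
    have w02 : Real.cos θ * (-Real.sin ψ) - Real.cos ψ * (-Real.sin θ) = Real.sin α := by
      rw [hS]; ring
    have w03 : Real.cos θ * Real.cos ψ - Real.sin ψ * (-Real.sin θ) = Real.cos α := by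
      rw [hC]; ring
    have w12 : Real.sin θ * (-Real.sin ψ) - Real.cos ψ * Real.cos θ = -Real.cos α := by
      rw [hC]; ring
    have w13 : Real.sin θ * Real.cos ψ - Real.sin ψ * Real.cos θ = Real.sin α := by
      rw [hS]; ring
    have w23 : Real.cos ψ * Real.cos ψ - Real.sin ψ * (-Real.sin ψ) = 1 := by linarith
    rw [hx, hu]
    simp only [A_lincomb_left, A_lincomb_right, w01, w02, w03, w12, w13, w23]
    simp only [selfDualQuartic, M.A_normalize b]
    ring
  have s2 : M.A (b' 0 + b' 2) (b' 1 - b' 3) (b' 0 + b' 2) (b' 1 - b' 3) =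
      M.antiSelfDualQuartic b β := by
    have hS : Real.sin β = Real.sin θ * Real.cos ψ + Real.cos θ * Real.sin ψ := by
      rw [hβ, Real.sin_add]
    have hC : Real.cos β = Real.cos θ * Real.cos ψ - Real.sin θ * Real.sin ψ := by
      rw [hβ, Real.cos_add]
    have w01 : Real.cos θ * Real.cos θ - Real.sin θ * (-Real.sin θ) = 1 := by linarith
    have w02 : Real.cos θ * Real.sin ψ - Real.cos ψ * (-Real.sin θ) = Real.sin β := by
      rw [hS]; ring
    have w03 : Real.cos θ * (-Real.cos ψ) - Real.sin ψ * (-Real.sin θ) = -Real.cos β := by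
      rw [hC]; ring
    have w12 : Real.sin θ * Real.sin ψ - Real.cos ψ * Real.cos θ = -Real.cos β := by
      rw [hC]; ring
    have w13 : Real.sin θ * (-Real.cos ψ) - Real.sin ψ * Real.cos θ = -Real.sin β := by
      rw [hS]; ring
    have w23 : Real.cos ψ * (-Real.cos ψ) - Real.sin ψ * Real.sin ψ = -1 := by linarith
    rw [hx, hv]
    simp only [A_lincomb_left, A_lincomb_right, w01, w02, w03, w12, w13, w23]
    simp only [antiSelfDualQuartic, M.A_normalize b]
    ring
  rwa [s1, s2] at hmul

end CurvatureModel

/-! ### Self-dual Einstein curvature in components -/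

namespace CurvatureModel
variable {V : Type*} [AddCommGroup V] [Module ℝ V]
variable {M : CurvatureModel V} {b : Module.Basis (Fin 4) ℝ V}

open Module

/-- Exchanging e₀ and e₁ reverses the orientation and so exchanges Λ⁺ and Λ⁻. On the null conics it
exchanges sine and cosine, whence π/2 - β; the overall sign of the bivector is lost in the quadratic
expression. -/
theorem antiSelfDualQuartic_reindex_swap (M : CurvatureModel V) (b : Basis (Fin 4) ℝ V) (β : ℝ) :
    M.antiSelfDualQuartic (b.reindex (Equiv.swap 0 1)) β =
      M.selfDualQuartic b (Real.pi / 2 - β) := by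
  have h0 : b.reindex (Equiv.swap 0 1) 0 = b 1 := by simp
  have h1 : b.reindex (Equiv.swap 0 1) 1 = b 0 := by simp
  have h2 : b.reindex (Equiv.swap 0 1) 2 = b 2 := by
    simp [Equiv.swap_apply_of_ne_of_ne (show (2 : Fin 4) ≠ 0 by decide)]
  have h3 : b.reindex (Equiv.swap 0 1) 3 = b 3 := by
    simp [Equiv.swap_apply_of_ne_of_ne (show (3 : Fin 4) ≠ 0 by decide)]
  simp only [antiSelfDualQuartic, selfDualQuartic, h0, h1, h2, h3, Real.sin_pi_div_two_sub,
    Real.cos_pi_div_two_sub, M.A_normalize b]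
  ring

theorem IsFrame.reindex_swap (hb : M.IsFrame b) : M.IsFrame (b.reindex (Equiv.swap 0 1)) := by
  intro i j
  rw [Basis.reindex_apply, Basis.reindex_apply, hb]
  simp only [EmbeddingLike.apply_eq_iff_eq]
  congr 1
  fin_cases i <;> simp [frameSign, Equiv.swap_apply_def]

variable [FiniteDimensional ℝ V]

/-- The Ricci tensor in an orthonormal frame, for an Einstein model. -/
theorem IsFrame.einstein_components (hb : M.IsFrame b) {c : ℝ}
    (hc : ∀ x y, M.ricci x y = c * M.form x y) :
    M.A (b 0) (b 1) (b 0) (b 1) - M.A (b 0) (b 2) (b 0) (b 2) - M.A (b 0) (b 3) (b 0) (b 3) = -c ∧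
    M.A (b 0) (b 1) (b 0) (b 1) - M.A (b 1) (b 2) (b 1) (b 2) - M.A (b 1) (b 3) (b 1) (b 3) = -c ∧
    M.A (b 0) (b 2) (b 0) (b 2) + M.A (b 1) (b 2) (b 1) (b 2) - M.A (b 2) (b 3) (b 2) (b 3) = c ∧
    M.A (b 0) (b 3) (b 0) (b 3) + M.A (b 1) (b 3) (b 1) (b 3) - M.A (b 2) (b 3) (b 2) (b 3) = c ∧
    M.A (b 0) (b 2) (b 1) (b 2) + M.A (b 0) (b 3) (b 1) (b 3) = 0 ∧
    M.A (b 0) (b 1) (b 1) (b 2) + M.A (b 0) (b 3) (b 2) (b 3) = 0 ∧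
    M.A (b 0) (b 1) (b 1) (b 3) - M.A (b 0) (b 2) (b 2) (b 3) = 0 ∧
    M.A (b 0) (b 1) (b 0) (b 2) - M.A (b 1) (b 3) (b 2) (b 3) = 0 ∧
    M.A (b 0) (b 1) (b 0) (b 3) + M.A (b 1) (b 2) (b 2) (b 3) = 0 ∧
    M.A (b 0) (b 2) (b 0) (b 3) + M.A (b 1) (b 2) (b 1) (b 3) = 0 := by
  have h : ∀ i j, (∑ k, frameSign k * M.A (b k) (b i) (b j) (b k)) =
      c * (if i = j then frameSign i else 0) := fun i j => by
    rw [← hb.ricci_eq, hc, hb]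
  have h00 := h 0 0
  have h11 := h 1 1
  have h22 := h 2 2
  have h33 := h 3 3
  have h01 := h 0 1
  have h02 := h 0 2
  have h03 := h 0 3
  have h12 := h 1 2
  have h13 := h 1 3
  have h23 := h 2 3
  simp [Fin.sum_univ_four, M.A_normalize b, A_self_left, A_self_right, frameSign]
    at h00 h11 h22 h33 h01 h02 h03 h12 h13 h23
  refine ⟨?_, ?_, ?_, ?_, ?_, ?_, ?_, ?_, ?_, ?_⟩ <;> linarith

/-- The components of a self-dual Einstein curvature tensor with Einstein constant `3 * k` in an
orthonormal frame. -/
structure HasSelfDualComponents (M : CurvatureModel V) (b : Fin 4 → V) (k : ℝ) : Prop where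
  eq_0101 : M.A (b 0) (b 1) (b 0) (b 1) = M.A (b 0) (b 1) (b 2) (b 3) - k
  eq_2323 : M.A (b 2) (b 3) (b 2) (b 3) = M.A (b 0) (b 1) (b 2) (b 3) - k
  eq_0202 : M.A (b 0) (b 2) (b 0) (b 2) = M.A (b 0) (b 2) (b 1) (b 3) + k
  eq_1313 : M.A (b 1) (b 3) (b 1) (b 3) = M.A (b 0) (b 2) (b 1) (b 3) + k
  eq_0303 : M.A (b 0) (b 3) (b 0) (b 3) = k - M.A (b 0) (b 3) (b 1) (b 2)
  eq_1212 : M.A (b 1) (b 2) (b 1) (b 2) = k - M.A (b 0) (b 3) (b 1) (b 2)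
  eq_0113 : M.A (b 0) (b 1) (b 1) (b 3) = M.A (b 0) (b 1) (b 0) (b 2)
  eq_0223 : M.A (b 0) (b 2) (b 2) (b 3) = M.A (b 0) (b 1) (b 0) (b 2)
  eq_1323 : M.A (b 1) (b 3) (b 2) (b 3) = M.A (b 0) (b 1) (b 0) (b 2)
  eq_0112 : M.A (b 0) (b 1) (b 1) (b 2) = -M.A (b 0) (b 1) (b 0) (b 3)
  eq_0323 : M.A (b 0) (b 3) (b 2) (b 3) = M.A (b 0) (b 1) (b 0) (b 3)
  eq_1223 : M.A (b 1) (b 2) (b 2) (b 3) = -M.A (b 0) (b 1) (b 0) (b 3)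
  eq_0212 : M.A (b 0) (b 2) (b 1) (b 2) = -M.A (b 0) (b 2) (b 0) (b 3)
  eq_0313 : M.A (b 0) (b 3) (b 1) (b 3) = M.A (b 0) (b 2) (b 0) (b 3)
  eq_1213 : M.A (b 1) (b 2) (b 1) (b 3) = -M.A (b 0) (b 2) (b 0) (b 3)

/-- The hypothesis is a trigonometric polynomial of degree 2 in β, so five angles determine its five
coefficients. They fix the curvature on Λ⁻ up to a multiple of the metric, and the Bianchi and
Einstein identities supply the rest. -/
theorem IsFrame.hasSelfDualComponents (hb : M.IsFrame b) {c : ℝ}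
    (hc : ∀ x y, M.ricci x y = c * M.form x y) (h : ∀ β, M.antiSelfDualQuartic b β = 0) :
    M.HasSelfDualComponents b (c / 3) := by
  obtain ⟨e1, e2, e3, e4, e5, e6, e7, e8, e9, e10⟩ := hb.einstein_components hc
  have hB := M.A_bianchi (b 0) (b 1) (b 2) (b 3)
  simp only [M.A_normalize b] at hB
  have q1 := h 0
  have q2 := h Real.pi
  have q3 := h (Real.pi / 2)
  have q4 := h (-(Real.pi / 2))
  have q5 := h (Real.pi / 4)
  have hs : √2 * √2 = (2 : ℝ) := Real.mul_self_sqrt (by norm_num)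
  simp only [antiSelfDualQuartic, Real.sin_zero, Real.cos_zero, Real.sin_pi, Real.cos_pi,
    Real.sin_neg, Real.cos_neg, Real.sin_pi_div_two, Real.cos_pi_div_two] at q1 q2 q3 q4
  simp only [antiSelfDualQuartic, Real.sin_pi_div_four, Real.cos_pi_div_four] at q5
  have q12 : M.A (b 0) (b 1) (b 0) (b 2) - M.A (b 0) (b 1) (b 1) (b 3)
      - M.A (b 0) (b 2) (b 2) (b 3) + M.A (b 1) (b 3) (b 2) (b 3) = 0 := by
    linarith only [q1, q2, q3, q4]
  have q13 : M.A (b 0) (b 1) (b 0) (b 3) + M.A (b 0) (b 1) (b 1) (b 2)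
      - M.A (b 0) (b 3) (b 2) (b 3) - M.A (b 1) (b 2) (b 2) (b 3) = 0 := by
    linarith only [q1, q2, q3, q4]
  have q5' : (M.A (b 0) (b 1) (b 0) (b 1) - 2 * M.A (b 0) (b 1) (b 2) (b 3)
      + M.A (b 2) (b 3) (b 2) (b 3))
      + 1 / 2 * (M.A (b 0) (b 2) (b 0) (b 2) - 2 * M.A (b 0) (b 2) (b 1) (b 3)
      + M.A (b 1) (b 3) (b 1) (b 3))
      + 1 / 2 * (M.A (b 0) (b 3) (b 0) (b 3) + 2 * M.A (b 0) (b 3) (b 1) (b 2)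
      + M.A (b 1) (b 2) (b 1) (b 2))
      - (M.A (b 0) (b 2) (b 0) (b 3) + M.A (b 0) (b 2) (b 1) (b 2)
      - M.A (b 0) (b 3) (b 1) (b 3) - M.A (b 1) (b 2) (b 1) (b 3)) = 0 := by
    rw [q12, q13] at q5
    have h1 : (√2 / 2) ^ 2 = (1 / 2 : ℝ) := by rw [div_pow, pow_two, hs]; norm_num
    have h2 : 2 * (√2 / 2) * (√2 / 2) = (1 : ℝ) := by linear_combination hs / 2
    rw [h1, h2] at q5
    linarith only [q5]
  norm_num at q1 q2 q3 q4
  have q23 : M.A (b 0) (b 2) (b 0) (b 3) + M.A (b 0) (b 2) (b 1) (b 2)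
      - M.A (b 0) (b 3) (b 1) (b 3) - M.A (b 1) (b 2) (b 1) (b 3) = 0 := by
    linarith only [q1, q2, q3, q4, q5']
  constructor
  iterate 6 linarith only [e1, e2, e3, e4, hB, q1, q2, q3, q4]
  iterate 3 linarith only [q12, e7, e8]
  iterate 3 linarith only [q13, e6, e9]
  iterate 3 linarith only [q23, e5, e10]

theorem IsFrame.domRestrict_weylOperator_eq_zero_iff_components (hb : M.IsFrame b) {c : ℝ}
    (hc : ∀ x y, M.ricci x y = c * M.form x y) :
    (M.weylOperator b).domRestrict (antiSelfDualForms b) = 0 ↔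
      M.HasSelfDualComponents b (c / 3) := by
  rw [domRestrict_weylOperator_eq_zero_iff]
  constructor
  · intro h
    have h01 := h 0 1 (by decide)
    have h02 := h 0 2 (by decide)
    have h03 := h 0 3 (by decide)
    have h12 := h 1 2 (by decide)
    have h13 := h 1 3 (by decide)
    have h23 := h 2 3 (by decide)
    clear h
    simp [hb.weyl_eq hc, hb _ _, frameSign, M.A_normalize b] at h01 h02 h03 h12 h13 h23
    constructor <;> linarith
  · intro h k l hkl
    fin_cases k <;> fin_cases l <;> simp at hkl <;>
      simp [hb.weyl_eq hc, hb _ _, frameSign, M.A_normalize b, h.eq_0101, h.eq_2323,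
        h.eq_0202, h.eq_1313, h.eq_0303, h.eq_1212, h.eq_0113, h.eq_0223, h.eq_1323, h.eq_0112,
        h.eq_0323, h.eq_1223, h.eq_0212, h.eq_0313, h.eq_1213]

theorem IsFrame.exists_isSelfDual (hb : M.IsFrame b) (hE : M.IsEinstein)
    (h : ∀ β, M.antiSelfDualQuartic b β = 0) : ∃ o : Orientation ℝ V (Fin 4), M.IsSelfDual o := by
  obtain ⟨c, hc⟩ := hE
  exact ⟨b.orientation, b, ⟨rfl, hb⟩,
    (hb.domRestrict_weylOperator_eq_zero_iff_components hc).2 (hb.hasSelfDualComponents hc h)⟩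

theorem NullTraceFree.isEinstein_and_exists_isSelfDual (h : M.NullTraceFree) (hM : M.IsNeutral) :
    M.IsEinstein ∧ ∃ o : Orientation ℝ V (Fin 4), M.IsSelfDual o := by
  obtain ⟨b, hb⟩ := M.exists_isFrame hM
  -- By definition tr J(x) is ρ(x, x).
  have hE : M.IsEinstein := hb.isEinstein_of_ricci_null fun x hx => (h x hx).1
  refine ⟨hE, ?_⟩
  by_cases hG : ∀ β, M.antiSelfDualQuartic b β = 0
  · exact hb.exists_isSelfDual hE hG
  -- One non-zero anti-self-dual value kills the self-dual factor at every angle, so the opposite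
  -- orientation works.
  · obtain ⟨β, hβ⟩ := not_forall.1 hG
    refine hb.reindex_swap.exists_isSelfDual hE fun γ => ?_
    rw [antiSelfDualQuartic_reindex_swap]
    exact (mul_eq_zero.1 (hb.quartic_mul_eq_zero h _ β)).resolve_right hβ

end CurvatureModel

/-! ### Para-quaternionic factorization of the Jacobi operator -/

namespace CurvatureModel
variable {V : Type*} [AddCommGroup V] [Module ℝ V]

open Module

/-- The columns are the coordinates of `x` and of its images under the endomorphisms that
correspond to the self-dual two-forms `e⁰¹ + e²³`, `e⁰² + e¹³`, `e⁰³ - e¹²`. -/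
def selfDualMatrix (x : Fin 4 → ℝ) : Matrix (Fin 4) (Fin 4) ℝ :=
  !![x 0, x 1, x 2, x 3;
     x 1, -x 0, x 3, -x 2;
     x 2, -x 3, x 0, -x 1;
     x 3, x 2, x 1, x 0]

/-- The metric adjoint of `selfDualMatrix x`. -/
def selfDualAdjoint (x : Fin 4 → ℝ) : Matrix (Fin 4) (Fin 4) ℝ :=
  !![-x 0, -x 1, x 2, x 3;
     -x 1, x 0, -x 3, x 2;
     x 2, x 3, -x 0, -x 1;
     x 3, -x 2, x 1, -x 0]

theorem selfDualMatrix_mul_adjoint (x : Fin 4 → ℝ) :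
    selfDualMatrix x * selfDualAdjoint x = (-x 0 ^ 2 - x 1 ^ 2 + x 2 ^ 2 + x 3 ^ 2) • 1 := by
  ext i j
  fin_cases i <;> fin_cases j <;>
    simp [selfDualMatrix, selfDualAdjoint, Matrix.mul_apply, Fin.sum_univ_four] <;> ring

theorem selfDualAdjoint_mul_matrix (x : Fin 4 → ℝ) :
    selfDualAdjoint x * selfDualMatrix x = (-x 0 ^ 2 - x 1 ^ 2 + x 2 ^ 2 + x 3 ^ 2) • 1 := by
  ext i j
  fin_cases i <;> fin_cases j <;>
    simp [selfDualMatrix, selfDualAdjoint, Matrix.mul_apply, Fin.sum_univ_four] <;> ring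

/-- The matrix of the Jacobi operator `J(x)` of a self-dual Einstein model, for a unit spacelike
`x`, in the basis given by the columns of `selfDualMatrix x`. -/
def jacobiModelMatrix (M : CurvatureModel V) (b : Fin 4 → V) (k : ℝ) :
    Matrix (Fin 4) (Fin 4) ℝ :=
  !![0, 0, 0, 0;
     0, k - M.A (b 0) (b 1) (b 2) (b 3), M.A (b 0) (b 1) (b 0) (b 2), M.A (b 0) (b 1) (b 0) (b 3);
     0, -M.A (b 0) (b 1) (b 0) (b 2), k + M.A (b 0) (b 2) (b 1) (b 3),
      M.A (b 0) (b 2) (b 0) (b 3);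
     0, -M.A (b 0) (b 1) (b 0) (b 3), M.A (b 0) (b 2) (b 0) (b 3),
      k - M.A (b 0) (b 3) (b 1) (b 2)]

theorem IsFrame.form_self_eq {M : CurvatureModel V} {b : Basis (Fin 4) ℝ V} (hb : M.IsFrame b)
    (x : V) : M.form x x =
      -b.repr x 0 ^ 2 - b.repr x 1 ^ 2 + b.repr x 2 ^ 2 + b.repr x 3 ^ 2 := by
  conv_lhs => rw [← b.sum_repr x, Fin.sum_univ_four]
  simp [hb _ _, frameSign]
  ring

set_option maxHeartbeats 1000000 in
-- An identity between quadratic polynomials in x, with no condition on ⟨x, x⟩; hence the same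
-- factorization serves unit and null vectors.
theorem HasSelfDualComponents.A_apply {M : CurvatureModel V} {b : Fin 4 → V} {k : ℝ}
    (h : M.HasSelfDualComponents b k) (x : Fin 4 → ℝ) (i j : Fin 4) :
    frameSign i * M.A (b j) (x 0 • b 0 + x 1 • b 1 + x 2 • b 2 + x 3 • b 3)
      (x 0 • b 0 + x 1 • b 1 + x 2 • b 2 + x 3 • b 3) (b i) =
      (selfDualMatrix x * M.jacobiModelMatrix b k * selfDualAdjoint x) i j := by
  simp only [map_add, map_smul, LinearMap.add_apply, LinearMap.smul_apply, smul_eq_mul,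
    Matrix.mul_apply, Fin.sum_univ_four]
  fin_cases i <;> fin_cases j <;>
    simp [selfDualMatrix, selfDualAdjoint, jacobiModelMatrix, frameSign, A_self_left,
      A_self_right, M.A_normalize b, h.eq_0101, h.eq_2323, h.eq_0202, h.eq_1313, h.eq_0303,
      h.eq_1212, h.eq_0113, h.eq_0223, h.eq_1323, h.eq_0112, h.eq_0323, h.eq_1223, h.eq_0212,
      h.eq_0313, h.eq_1213] <;> ring

variable [FiniteDimensional ℝ V]
variable {M : CurvatureModel V} {b : Basis (Fin 4) ℝ V} {k : ℝ}

theorem IsFrame.toMatrix_jacobi (hb : M.IsFrame b) (h : M.HasSelfDualComponents b k) (x : V) :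
    LinearMap.toMatrix b b (M.jacobi x) =
      selfDualMatrix (b.repr x) * M.jacobiModelMatrix b k * selfDualAdjoint (b.repr x) := by
  ext i j
  rw [LinearMap.toMatrix_apply, hb.coord_eq, form_jacobi, ← h.A_apply]
  have hx : x = b.repr x 0 • b 0 + b.repr x 1 • b 1 + b.repr x 2 • b 2 + b.repr x 3 • b 3 := by
    conv_lhs => rw [← b.sum_repr x, Fin.sum_univ_four]
  rw [← hx]

theorem IsFrame.exists_conj_jacobi (hb : M.IsFrame b) (h : M.HasSelfDualComponents b k) {x : V}
    {ε : ℝ} (hε : ε * ε = 1) (hx : M.form x x = ε) : ∃ e : V ≃ₗ[ℝ] V,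
      e.conj (ε • Matrix.toLin b b (M.jacobiModelMatrix b k)) = M.jacobi x := by
  have hq := hb.form_self_eq x
  rw [hx] at hq
  have h1 := selfDualMatrix_mul_adjoint (b.repr x)
  have h2 := selfDualAdjoint_mul_matrix (b.repr x)
  rw [← hq] at h1 h2
  -- Since S S* = ε and ε² = 1, the inverse of S is εS*, and S K S* = S (εK) (εS*).
  refine ⟨LinearEquiv.ofLinearMap (Matrix.toLin b b (selfDualMatrix (b.repr x)))
    (Matrix.toLin b b (ε • selfDualAdjoint (b.repr x))) ?_ ?_, ?_⟩
  · rw [← Matrix.toLin_mul, Matrix.mul_smul, h1, smul_smul, hε, one_smul, Matrix.toLin_one]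
  · rw [← Matrix.toLin_mul, Matrix.smul_mul, h2, smul_smul, hε, one_smul, Matrix.toLin_one]
  · have hJ : M.jacobi x = Matrix.toLin b b (selfDualMatrix (b.repr x)) ∘ₗ
        Matrix.toLin b b (M.jacobiModelMatrix b k) ∘ₗ
        Matrix.toLin b b (selfDualAdjoint (b.repr x)) := by
      rw [← Matrix.toLin_mul b b b, ← Matrix.toLin_mul b b b, ← Matrix.mul_assoc,
        ← hb.toMatrix_jacobi h x, Matrix.toLin_toMatrix]
    ext v
    simp [hJ, LinearEquiv.conj_apply, smul_smul, hε]

theorem IsFrame.jordanOssermanOn (hb : M.IsFrame b) (h : M.HasSelfDualComponents b k) {ε : ℝ}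
    (hε : ε * ε = 1) : M.JordanOssermanOn {x | M.form x x = ε} := by
  intro x hx y hy
  obtain ⟨e, he⟩ := hb.exists_conj_jacobi h hε hx
  obtain ⟨f, hf⟩ := hb.exists_conj_jacobi h hε hy
  refine ⟨e.symm.trans f, ?_⟩
  rw [← he, ← hf]
  ext v
  simp [LinearEquiv.conj_apply]

/-- J(x)² = S K (S* S) K S*, and the middle factor is ⟨x, x⟩ = 0. -/
theorem IsFrame.jacobi_mul_jacobi_of_null (hb : M.IsFrame b) (h : M.HasSelfDualComponents b k)
    {x : V} (hx : M.form x x = 0) : M.jacobi x * M.jacobi x = 0 := by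
  have h2 := selfDualAdjoint_mul_matrix (b.repr x)
  rw [← hb.form_self_eq x, hx, zero_smul] at h2
  apply (LinearMap.toMatrix b b).injective
  rw [LinearMap.toMatrix_mul, hb.toMatrix_jacobi h x, map_zero]
  simp only [Matrix.mul_assoc]
  rw [← Matrix.mul_assoc (selfDualAdjoint _) (selfDualMatrix _), h2]
  simp

theorem jacobiEigenvalues_eq_zero {x : V} (hx0 : x ≠ 0) (h : M.jacobi x * M.jacobi x = 0) :
    M.jacobiEigenvalues x = {0} := by
  have : Nontrivial V := ⟨x, 0, hx0⟩
  have hcp : (M.jacobi x).charpoly = Polynomial.X ^ finrank ℝ V :=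
    IsNilpotent.charpoly_eq_X_pow_finrank ⟨2, by rw [pow_two, h]⟩
  ext μ
  rw [jacobiEigenvalues, Set.mem_ofPred_eq, End.hasEigenvalue_iff_isRoot_charpoly,
    LinearMap.charpoly_baseChange, hcp]
  simp [finrank_pos.ne']

theorem JordanOssermanOn.ossermanOn {S : Set V} (h : M.JordanOssermanOn S) : M.OssermanOn S := by
  intro x hx y hy
  obtain ⟨e, he⟩ := h x hx y hy
  ext μ
  simp only [jacobiEigenvalues, Set.mem_ofPred_eq, End.hasEigenvalue_iff_isRoot_charpoly,
    LinearMap.charpoly_baseChange]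
  rw [← he, LinearEquiv.charpoly_conj]

theorem exists_isFrame_and_hasSelfDualComponents
    (h : M.IsEinstein ∧ ∃ o : Orientation ℝ V (Fin 4), M.IsSelfDual o) :
    ∃ (b : Basis (Fin 4) ℝ V) (k : ℝ), M.IsFrame b ∧ M.HasSelfDualComponents b k := by
  obtain ⟨⟨c, hc⟩, o, b, ⟨-, hb⟩, hw⟩ := h
  exact ⟨b, c / 3, hb, (IsFrame.domRestrict_weylOperator_eq_zero_iff_components hb hc).1 hw⟩

end CurvatureModel

/-! ### The equivalence of the six conditions -/

theorem theorem1p1 {V : Type*} [AddCommGroup V] [Module ℝ V] [FiniteDimensional ℝ V]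
    (M : CurvatureModel V) (hM : M.IsNeutral) :
    List.TFAE [
      M.SpacelikeOsserman,
      M.TimelikeOsserman,
      M.SpacelikeJordanOsserman,
      M.TimelikeJordanOsserman,
      M.IsEinstein ∧ ∃ o : Orientation ℝ V (Fin 4), M.IsSelfDual o,
      M.NullOsserman] := by
  tfae_have 1 → 5 := fun h =>
    (M.nullTraceFree_of_ossermanOn_unit h).isEinstein_and_exists_isSelfDual hM
  tfae_have 2 → 5 := fun h =>
    (M.nullTraceFree_of_ossermanOn_unit h).isEinstein_and_exists_isSelfDual hM
  tfae_have 6 → 5 := fun h =>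
    (CurvatureModel.NullOsserman.nullTraceFree h).isEinstein_and_exists_isSelfDual hM
  tfae_have 5 → 3 := fun h => by
    obtain ⟨b, k, hb, hk⟩ := CurvatureModel.exists_isFrame_and_hasSelfDualComponents h
    exact hb.jordanOssermanOn hk (by norm_num)
  tfae_have 5 → 4 := fun h => by
    obtain ⟨b, k, hb, hk⟩ := CurvatureModel.exists_isFrame_and_hasSelfDualComponents h
    exact hb.jordanOssermanOn hk (by norm_num)
  tfae_have 5 → 6 := fun h => by
    obtain ⟨b, k, hb, hk⟩ := CurvatureModel.exists_isFrame_and_hasSelfDualComponents h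
    intro x hx y hy
    rw [CurvatureModel.jacobiEigenvalues_eq_zero hx.1 (hb.jacobi_mul_jacobi_of_null hk hx.2),
      CurvatureModel.jacobiEigenvalues_eq_zero hy.1 (hb.jacobi_mul_jacobi_of_null hk hy.2)]
  tfae_have 3 → 1 := CurvatureModel.JordanOssermanOn.ossermanOn
  tfae_have 4 → 2 := CurvatureModel.JordanOssermanOn.ossermanOn
  tfae_finish
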